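/- Let $A\in\{0,\star\}^{d\times d}$ and $B\in\{0,\star\}^{d\times m}$ be sparsity matrices ($\star$ marks a free real parameter, $0$ a fixed zero). A numerical realisation of a sparsity matrix replaces every $\star$ by a real number and every $0$ by $0$. A pair of sparsity matrices is structurally controllable if it has a numerical realisation $(A',B')$ for which the system $\dot x=A'x+B'u$ is controllable. Assume that $(A,B)$ is structurally controllable. Let every non-zero entry $B_{ij}$ have a real cost $w_{ij}\ge 0$, and put $w_{ij}=\infty$ where $B_{ij}=0$. Let $G(A)$ be the digraph on $v_1,\dots,v_d$ with an edge $(v_j,v_i)$ whenever $A_{ij}\neq0$; a strongly connected component of $G(A)$ is a *source* component (SSCC) if no edge enters it from another component. Let $\Gamma(A)$ be the bipartite graph with vertex classes $\{v^1_1,\dots,v^1_d\}$ and $\{v^2_1,\dots,v^2_d\}$ in which $v^1_j$ and $v^2_i$ are joined whenever $A_{ij}\ne0$. Assume that $\Gamma(A)$ has a perfect matching. Consider the following algorithm. Start with $L=\emptyset$. For each SSCC $\mathcal S$ of $G(A)$: for each $v_i\in\mathcal S$ choose an index $k(i)\in\{1,\dots,m\}$ with $w_{i\,k(i)}$ smallest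 among $w_{i1},\dots,w_{im}$; then choose $v_\ell\in\mathcal S$ with $w_{\ell\,k(\ell)}$ least among all $v_i\in\mathcal S$; add the pair $(u_{k(\ell)},v_\ell)$ to $L$. Finally let $B^*\in\{0,\star\}^{d\times m}$ have $B^*_{\ell k}=\star$ exactly when $(u_k,v_\ell)\in L$. Then the algorithm can be carried out, and, whatever the order in which the SSCCs are visited and however ties are broken, every matrix $B^*$ that it produces solves the minimum-cost problem without a sparsity constraint $$(\mathcal P_1)\qquad \min_{B'\in\mathcal K}\ \|B'\|_w,\qquad \|B'\|_w=\sum_{i,j:\,B'_{ij}\neq0}w_{ij},$$ where $\mathcal K$ is the set of all $B'\in\{0,\star\}^{d\times m}$ such that $B'_{ij}=0$ whenever $B_{ij}=0$ and $(A,B')$ is structurally controllable. That is, $B^*\in\mathcal K$ and $\|B^*\|_w\le\|B'\|_w$ for all $B'\in\mathcal K$. -/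

import Mathlib

namespace StructCtrl

/-- The two symbols `0` and `⋆` that a sparsity matrix is made of. -/
inductive Entry
  | zero
  | star
  deriving DecidableEq

instance : Zero Entry := ⟨Entry.zero⟩

/-- Sparsity matrices, the elements of `{0, ⋆}^{n × k}`. -/
abbrev Pattern (n k : ℕ) := Matrix (Fin n) (Fin k) Entry

/-! ### Controllability and structural controllability -/

/-- Controllability of `x'(t) = A x(t) + B u(t)`: every state can be steered to every state in
some finite time by a continuous input. -/
def IsControllable {d m : ℕ} (A : Matrix (Fin d) (Fin d) ℝ) (B : Matrix (Fin d) (Fin m) ℝ) :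
    Prop :=
  ∀ x₀ x₁ : Fin d → ℝ, ∃ T : ℝ, 0 < T ∧
    ∃ (u : ℝ → Fin m → ℝ) (x : ℝ → Fin d → ℝ),
      ContinuousOn u (Set.Icc 0 T) ∧ x 0 = x₀ ∧ x T = x₁ ∧
      ∀ t ∈ Set.Icc 0 T,
        HasDerivWithinAt x (A.mulVec (x t) + B.mulVec (u t)) (Set.Icc 0 T) t

/-- `R` is a numerical realisation of the sparsity matrix `N`: arbitrary real numbers (zero is
allowed) are put in the places of the stars, and the fixed zeros are kept. -/
def IsRealisation {n k : ℕ} (N : Pattern n k) (R : Matrix (Fin n) (Fin k) ℝ) : Prop :=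
  ∀ i j, N i j = 0 → R i j = 0

/-- The pair `(A, B)` of sparsity matrices has a controllable numerical realisation. -/
def StructurallyControllable {d m : ℕ} (A : Pattern d d) (B : Pattern d m) : Prop :=
  ∃ (A' : Matrix (Fin d) (Fin d) ℝ) (B' : Matrix (Fin d) (Fin m) ℝ),
    IsRealisation A A' ∧ IsRealisation B B' ∧ IsControllable A' B'

/-! ### The optimisation problem -/

/-- `Z(N)`, the set of locations of the fixed zeros of `N`. -/
def fixedZeros {n k : ℕ} (N : Pattern n k) : Set (Fin n × Fin k) :=
  {p | N p.1 p.2 = 0}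

/-- The feasible set `𝒦`. -/
def feasible {d m : ℕ} (A : Pattern d d) (B : Pattern d m) : Set (Pattern d m) :=
  {B' | fixedZeros B ⊆ fixedZeros B' ∧ StructurallyControllable A B'}

/-- `‖N‖_w = ∑ i, ∑ j, w i j * 1_{N i j ≠ 0}`. -/
def totalCost {n k : ℕ} (w : Matrix (Fin n) (Fin k) ℝ) (N : Pattern n k) : ℝ :=
  ∑ i, ∑ j, w i j * (if N i j ≠ 0 then 1 else 0)

/-- `Bs` solves the problem "minimise `‖B'‖_w` over `B' ∈ 𝒦`". -/
def SolvesMinCost {d m : ℕ} (A : Pattern d d) (B : Pattern d m) (w : Matrix (Fin d) (Fin m) ℝ)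
    (Bs : Pattern d m) : Prop :=
  Bs ∈ feasible A B ∧ ∀ B' ∈ feasible A B, totalCost w Bs ≤ totalCost w B'

/-! ### The graphs of a system matrix -/

/-- The digraph `G(A)`: there is an edge from `v_j` to `v_i` when `A i j ≠ 0`. -/
def stateDigraph {d : ℕ} (A : Pattern d d) : Digraph (Fin d) where
  Adj j i := A i j ≠ 0

/-- The subgraph of `G` induced on the (nonempty) vertex set `S` is strongly connected: any vertex
of `S` can be reached from any other one along edges of `G` that stay in `S`. -/
def StronglyConnectedOn {V : Type*} (G : Digraph V) (S : Set V) : Prop :=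
  S.Nonempty ∧ ∀ a ∈ S, ∀ b ∈ S,
    Relation.ReflTransGen (fun x y => x ∈ S ∧ y ∈ S ∧ G.Adj x y) a b

/-- Strongly connected components, as vertex sets. -/
def IsSCC {V : Type*} (G : Digraph V) (S : Set V) : Prop :=
  Maximal (StronglyConnectedOn G) S

/-- Source strongly connected components: no edge enters from another component. -/
def IsSSCC {V : Type*} (G : Digraph V) (S : Set V) : Prop :=
  IsSCC G S ∧ ∀ S', IsSCC G S' → S' ≠ S → ∀ a ∈ S', ∀ b ∈ S, ¬ G.Adj a b

/-- The undirected bipartite graph `Γ(A)`. The vertex `v_j^1` is `Sum.inl j`, the vertex `v_i^2` is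
`Sum.inr i`, and these two are joined when `A i j ≠ 0`. -/
def bipartiteGraph {d : ℕ} (A : Pattern d d) : SimpleGraph (Fin d ⊕ Fin d) where
  Adj
    | Sum.inl j, Sum.inr i => A i j ≠ 0
    | Sum.inr i, Sum.inl j => A i j ≠ 0
    | _, _ => False
  symm := ⟨by rintro (a | a) (b | b) h <;> exact h⟩
  loopless := ⟨by rintro (a | a) h <;> exact h⟩

/-- `Γ(A)` has a perfect matching. -/
def HasPerfectMatching {d : ℕ} (A : Pattern d d) : Prop :=
  ∃ M : (bipartiteGraph A).Subgraph, M.IsPerfectMatching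

/-! ### The algorithm -/

/-- The costs that the algorithm works with: `w i k` if the connection from `u_k` to `v_i` is
present in `B`, and `∞` otherwise. -/
noncomputable def algCost {d m : ℕ} (B : Pattern d m) (w : Matrix (Fin d) (Fin m) ℝ)
    (i : Fin d) (k : Fin m) : WithTop ℝ :=
  if B i k ≠ 0 then (w i k : WithTop ℝ) else ⊤

/-- The loop of the algorithm. `Loop c Ss L L'` says that going through the components listed in
`Ss`, starting from the set `L` of input-connections, can end with the set `L'`. For a
component `S` one chooses for each state `v_i` in `S` an input `u_(κ i)` of smallest cost
among `c i 1, …, c i m`, then a state `v_ℓ` in `S` for which this smallest cost is least, and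
adds `(u_(κ ℓ), v_ℓ)` to `L`. Ties may be broken in any way. -/
inductive Loop {d m : ℕ} (c : Fin d → Fin m → WithTop ℝ) :
    List (Set (Fin d)) → Finset (Fin m × Fin d) → Finset (Fin m × Fin d) → Prop
  | nil (L : Finset (Fin m × Fin d)) : Loop c [] L L
  | cons (S : Set (Fin d)) (Ss : List (Set (Fin d))) (L L' : Finset (Fin m × Fin d))
      (κ : Fin d → Fin m) (hκ : ∀ i ∈ S, ∀ j, c i (κ i) ≤ c i j)
      (ℓ : Fin d) (hmem : ℓ ∈ S) (hmin : ∀ i ∈ S, c ℓ (κ ℓ) ≤ c i (κ i))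
      (hrest : Loop c Ss (insert (κ ℓ, ℓ) L) L') : Loop c (S :: Ss) L L'

/-- The sparsity matrix whose stars are the input-connections in `L`. -/
def patternOf {d m : ℕ} (L : Finset (Fin m × Fin d)) : Pattern d m :=
  fun ℓ k => if (k, ℓ) ∈ L then Entry.star else 0

/-- `Bs` is a possible output of the algorithm on the input `A`, `B` with the costs `w`: list the
source strongly connected components of `G(A)` in some order without repetition, run the loop on
the list from the empty set, and put stars at the selected input-connections. -/
def IsAlgorithmOutput {d m : ℕ} (A : Pattern d d) (B : Pattern d m)
    (w : Matrix (Fin d) (Fin m) ℝ) (Bs : Pattern d m) : Prop :=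
  ∃ Ss : List (Set (Fin d)), Ss.Nodup ∧ (∀ S, S ∈ Ss ↔ IsSSCC (stateDigraph A) S) ∧
    ∃ L : Finset (Fin m × Fin d), Loop (algCost B w) Ss ∅ L ∧ Bs = patternOf L

end StructCtrl

/-! Under a perfect matching, (A, B') is structurally controllable exactly when every source
component of G(A) contains a state with a star in its row of B'. Source components are pairwise
disjoint, so the problem splits: a feasible B' pays in each of them for at least one connection
allowed by B, and the algorithm pays for the cheapest.

Necessity (`IsControllable.exists_input_ne_zero`): in a source component without inputs the
coordinates obey an autonomous linear ODE, so they never leave 0.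

Sufficiency (`structurallyControllable_of_reachable`): the matching is a permutation σ whose cycles
are cycles of G(A). The realisation gives the σ-cycles distinct positive weights, links each cycle
of positive rank to a parent cycle one step closer to the inputs, and keeps one input state on each
cycle of rank 0. A left eigenvector is then nonzero on all of exactly one root cycle
(`exists_unique_root`), so the input there detects it and the Hautus test
(`isControllable_of_hautus`) applies. That test rests on the Kalman criterion, hence on
invertibility of the Gramian. -/

namespace StructCtrl

open scoped Matrix

/-! ### Matrix exponential flow. -/

section Gramian

variable {E : Type*} [NormedAddCommGroup E] [NormedSpace ℝ E]

/-- The flow `exp (t L)` of a bounded operator. -/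
noncomputable def flow (L : E →L[ℝ] E) (t : ℝ) : E →L[ℝ] E := NormedSpace.exp (t • L)

theorem flow_zero (L : E →L[ℝ] E) : flow L 0 = 1 := by
  simp [flow]

variable [CompleteSpace E]

theorem hasDerivAt_flow (L : E →L[ℝ] E) (t : ℝ) : HasDerivAt (flow L) (flow L t * L) t :=
  hasDerivAt_exp_smul_const L t

theorem hasDerivAt_flow' (L : E →L[ℝ] E) (t : ℝ) : HasDerivAt (flow L) (L * flow L t) t :=
  hasDerivAt_exp_smul_const' L t

theorem flow_mul_flow_neg (L : E →L[ℝ] E) (t : ℝ) : flow L t * flow L (-t) = 1 := by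
  let _ := NormedAlgebra.restrictScalars ℚ ℝ (E →L[ℝ] E)
  have := NormedSpace.exp_add_of_commute (𝔸 := E →L[ℝ] E)
    (x := t • L) (y := (-t) • L) (((Commute.refl L).smul_left t).smul_right (-t))
  rw [flow, flow, ← this, ← add_smul]
  simp

theorem continuous_flow (L : E →L[ℝ] E) : Continuous (flow L) :=
  continuous_iff_continuousAt.2 fun t => (hasDerivAt_flow L t).continuousAt

theorem hasDerivAt_flow_neg_apply (L : E →L[ℝ] E) (v : E) (t : ℝ) :
    HasDerivAt (fun s => flow L (-s) v) (-(flow L (-t) (L v))) t := by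
  have h := (hasDerivAt_flow L (-t)).scomp t (hasDerivAt_neg t)
  have := h.clm_apply (hasDerivAt_const t v)
  simpa [Function.comp_def] using this

/-- Differentiating p(exp(-sL) Lⁿ v) = 0 in s produces the next power of L. At the endpoints the
derivative within [0, 1] is still unique. -/
theorem flow_neg_pow_apply_eq_zero (L : E →L[ℝ] E) (p : E →L[ℝ] ℝ) (v : E)
    (h : ∀ s ∈ Set.Icc (0 : ℝ) 1, p (flow L (-s) v) = 0) (n : ℕ) :
    ∀ s ∈ Set.Icc (0 : ℝ) 1, p (flow L (-s) ((L ^ n) v)) = 0 := by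
  induction n with
  | zero => simpa using h
  | succ n ih =>
    intro s hs
    have h1 := (p.hasFDerivAt.comp_hasDerivAt s
      (hasDerivAt_flow_neg_apply L ((L ^ n) v) s)).hasDerivWithinAt (s := Set.Icc (0 : ℝ) 1)
    have h2 : HasDerivWithinAt (p ∘ fun s => flow L (-s) ((L ^ n) v)) 0 (Set.Icc (0 : ℝ) 1) s :=
      (hasDerivWithinAt_const s _ (0 : ℝ)).congr (fun t ht => ih t ht) (ih s hs)
    have h3 := (uniqueDiffOn_Icc (zero_lt_one' ℝ) s hs).eq_deriv _ h1 h2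
    rw [pow_succ']
    simpa using h3

end Gramian

/-- The action of a real matrix on column vectors, as a continuous linear map. -/
noncomputable def mulVecCLM {n k : ℕ} (M : Matrix (Fin n) (Fin k) ℝ) :
    (Fin k → ℝ) →L[ℝ] (Fin n → ℝ) :=
  LinearMap.toContinuousLinearMap M.mulVecLin

@[simp] theorem mulVecCLM_apply {n k : ℕ} (M : Matrix (Fin n) (Fin k) ℝ) (v : Fin k → ℝ) :
    mulVecCLM M v = M *ᵥ v := rfl

theorem mulVecCLM_pow_apply {n : ℕ} (M : Matrix (Fin n) (Fin n) ℝ) (v : Fin n → ℝ) (r : ℕ) :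
    (mulVecCLM M ^ r) v = (M ^ r) *ᵥ v := by
  induction r with
  | zero => simp
  | succ r ih => rw [pow_succ', pow_succ', ← Matrix.mulVec_mulVec, ← ih]; rfl

/-! ### Gramian, Kalman criterion, Hautus criterion. -/

section

variable {d m : ℕ} (A : Matrix (Fin d) (Fin d) ℝ) (B : Matrix (Fin d) (Fin m) ℝ)

/-- The input `t ↦ (exp (-tA) B)ᵀ p`. -/
noncomputable def gramianInput (p : Fin d → ℝ) (s : ℝ) : Fin m → ℝ :=
  fun k => p ⬝ᵥ flow (mulVecCLM A) (-s) (B *ᵥ Pi.single k 1)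

theorem continuous_flow_neg_apply {u : ℝ → Fin d → ℝ} (hu : Continuous u) :
    Continuous fun s => flow (mulVecCLM A) (-s) (u s) :=
  ((continuous_flow _).comp continuous_neg).clm_apply hu

theorem continuous_gramianInput (p : Fin d → ℝ) : Continuous (gramianInput A B p) := by
  refine continuous_pi fun k => ?_
  exact continuous_const.dotProduct (continuous_flow_neg_apply A continuous_const)

theorem continuous_mulVec_input {u : ℝ → Fin m → ℝ} (hu : Continuous u) :
    Continuous fun s => B *ᵥ u s :=
  (mulVecCLM B).continuous.comp hu

theorem continuous_gramian_integrand (p : Fin d → ℝ) :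
    Continuous fun s => flow (mulVecCLM A) (-s) (B *ᵥ gramianInput A B p s) :=
  continuous_flow_neg_apply A (continuous_mulVec_input B (continuous_gramianInput A B p))

/-- The controllability Gramian on `[0, 1]`, as a linear map. -/
noncomputable def gramian : (Fin d → ℝ) →ₗ[ℝ] (Fin d → ℝ) where
  toFun p := ∫ s in (0 : ℝ)..1, flow (mulVecCLM A) (-s) (B *ᵥ gramianInput A B p s)
  map_add' p q := by
    rw [← intervalIntegral.integral_add
      ((continuous_gramian_integrand A B p).intervalIntegrable _ _)
      ((continuous_gramian_integrand A B q).intervalIntegrable _ _)]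
    refine intervalIntegral.integral_congr fun s _ => ?_
    have : gramianInput A B (p + q) s = gramianInput A B p s + gramianInput A B q s := by
      ext k; simp [gramianInput, add_dotProduct]
    simp only [this, Matrix.mulVec_add, map_add]
  map_smul' c p := by
    rw [RingHom.id_apply, ← intervalIntegral.integral_smul]
    refine intervalIntegral.integral_congr fun s _ => ?_
    have : gramianInput A B (c • p) s = c • gramianInput A B p s := by
      ext k; simp [gramianInput, smul_dotProduct]
    simp only [this, Matrix.mulVec_smul, map_smul]

/-- The functional `v ↦ p ⬝ᵥ v`. -/
noncomputable def dotCLM (p : Fin d → ℝ) : (Fin d → ℝ) →L[ℝ] ℝ :=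
  LinearMap.toContinuousLinearMap (dotProductBilin ℝ ℝ p)

theorem dotCLM_apply (p v : Fin d → ℝ) : dotCLM p v = p ⬝ᵥ v := rfl

/-- The adjoint relation that turns the quadratic form of the Gramian into an integral of squares.
-/
theorem dot_flow_input (p : Fin d → ℝ) (s : ℝ) (u : Fin m → ℝ) :
    p ⬝ᵥ flow (mulVecCLM A) (-s) (B *ᵥ u) = gramianInput A B p s ⬝ᵥ u := by
  have : B *ᵥ u = ∑ k, u k • B *ᵥ Pi.single k 1 := by
    ext i
    simp [Matrix.mulVec, dotProduct, mul_comm]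
  rw [this, map_sum, dotProduct_sum]
  refine Finset.sum_congr rfl fun k _ => ?_
  rw [map_smul, dotProduct_smul, smul_eq_mul, mul_comm]
  rfl

theorem dot_gramian (p : Fin d → ℝ) :
    p ⬝ᵥ gramian A B p =
      ∫ s in (0 : ℝ)..1, gramianInput A B p s ⬝ᵥ gramianInput A B p s := by
  have := (dotCLM p).intervalIntegral_comp_comm (μ := MeasureTheory.volume)
    ((continuous_gramian_integrand A B p).intervalIntegrable 0 1)
  simp only [dotCLM_apply, dot_flow_input] at this
  exact this.symm

/-- If the Gramian kills p, the integral of |(exp(-sA) B)ᵀ p|² vanishes, hence so does the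
continuous integrand on [0, 1]; its derivatives at s = 0 give p · Aⁿ B u = 0. -/
theorem gramian_injective
    (h : ∀ p : Fin d → ℝ, (∀ (n : ℕ) (u : Fin m → ℝ), p ⬝ᵥ (A ^ n) *ᵥ B *ᵥ u = 0) → p = 0) :
    Function.Injective (gramian A B) := by
  rw [← LinearMap.ker_eq_bot, LinearMap.ker_eq_bot']
  intro p hp
  have h0 := dot_gramian A B p
  rw [hp, dotProduct_zero] at h0
  have hcont : Continuous fun s => gramianInput A B p s ⬝ᵥ gramianInput A B p s :=
    (continuous_gramianInput A B p).dotProduct (continuous_gramianInput A B p)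
  have hzero : ∀ s ∈ Set.Icc (0 : ℝ) 1, gramianInput A B p s = 0 := by
    by_contra! hne
    obtain ⟨s, hs, hs0⟩ := hne
    have : 0 < ∫ s in (0 : ℝ)..1, gramianInput A B p s ⬝ᵥ gramianInput A B p s := by
      refine intervalIntegral.integral_pos zero_lt_one hcont.continuousOn
        (fun t _ => Finset.sum_nonneg fun k _ => mul_self_nonneg _) ⟨s, hs, ?_⟩
      exact lt_of_le_of_ne (Finset.sum_nonneg fun k _ => mul_self_nonneg _)
        fun h => hs0 (dotProduct_self_eq_zero.1 h.symm)
    exact this.ne h0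
  refine h p fun n u => ?_
  have := flow_neg_pow_apply_eq_zero (mulVecCLM A) (dotCLM p) (B *ᵥ u) (fun s hs => by
    rw [dotCLM_apply, dot_flow_input, hzero s hs, zero_dotProduct]) n 0 (by simp)
  rwa [neg_zero, flow_zero, one_apply_eq_self, mulVecCLM_pow_apply] at this

/-- Kalman's criterion, in the form: the system is controllable if no nonzero `p` annihilates all
the vectors `Aⁿ B u`. -/
theorem isControllable_of_kalman
    (h : ∀ p : Fin d → ℝ, (∀ (n : ℕ) (u : Fin m → ℝ), p ⬝ᵥ (A ^ n) *ᵥ B *ᵥ u = 0) → p = 0) :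
    IsControllable A B := by
  intro x₀ x₁
  -- By variation of constants, x(1) = x₁ amounts to ∫₀¹ exp(-sA) B u(s) ds = exp(-A) x₁ - x₀.
  obtain ⟨p, hp⟩ := LinearMap.injective_iff_surjective.1 (gramian_injective A B h)
    (flow (mulVecCLM A) (-1) x₁ - x₀)
  set Φ := flow (mulVecCLM A)
  set g : ℝ → Fin d → ℝ := fun s => Φ (-s) (B *ᵥ gramianInput A B p s) with hg
  have hgc : Continuous g := continuous_gramian_integrand A B p
  have hinv : ∀ (t : ℝ) v, Φ t (Φ (-t) v) = v := fun t v =>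
    DFunLike.congr_fun (flow_mul_flow_neg (mulVecCLM A) t) v
  refine ⟨1, one_pos, gramianInput A B p, fun t => Φ t (x₀ + ∫ s in (0 : ℝ)..t, g s),
    (continuous_gramianInput A B p).continuousOn, by simp [Φ, flow_zero], ?_, fun t _ => ?_⟩
  · have hp' : ∫ s in (0 : ℝ)..1, g s = Φ (-1) x₁ - x₀ := hp
    simp only [hp', add_sub_cancel, hinv]
  · have h1 : HasDerivAt (fun t => x₀ + ∫ s in (0 : ℝ)..t, g s) (g t) t :=
      (hgc.integral_hasStrictDerivAt 0 t).hasDerivAt.const_add x₀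
    have h2 := (hasDerivAt_flow' (mulVecCLM A) t).clm_apply h1
    have h3 : Φ t (g t) = B *ᵥ gramianInput A B p t := hinv t _
    refine HasDerivAt.hasDerivWithinAt ?_
    convert h2 using 1
    change _ = A *ᵥ _ + Φ t (g t)
    rw [h3]
    rfl

/-- The Popov–Belevitch–Hautus criterion (sufficiency). -/
theorem isControllable_of_hautus
    (h : ∀ (μ : ℂ) (q : Fin d → ℂ), q ᵥ* A.map Complex.ofReal = μ • q →
      q ᵥ* B.map Complex.ofReal = 0 → q = 0) :
    IsControllable A B := by
  refine isControllable_of_kalman A B fun p hp => ?_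
  set A' := A.map Complex.ofReal with hA'
  set B' := B.map Complex.ofReal with hB'
  -- The unobservable row vectors form an invariant subspace; over ℂ, if nonzero, it contains an
  -- eigenvector, which the case n = 0 shows to be killed by B'.
  let N : Submodule ℂ (Fin d → ℂ) := ⨅ n : ℕ, LinearMap.ker (A' ^ n * B').vecMulLinear
  have hN : ∀ q, q ∈ N ↔ ∀ n : ℕ, q ᵥ* (A' ^ n * B') = 0 := fun q => by
    simp [N, Submodule.mem_iInf]
  have hinv : ∀ q ∈ N, A'.vecMulLinear q ∈ N := fun q hq => by
    rw [hN] at hq ⊢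
    intro n
    have := hq (n + 1)
    rwa [pow_succ', Matrix.mul_assoc, ← Matrix.vecMul_vecMul] at this
  have hpN : (fun i => (p i : ℂ)) ∈ N := by
    rw [hN]
    intro n
    have h1 : p ᵥ* (A ^ n * B) = 0 := by
      ext k
      have := hp n (Pi.single k 1)
      rw [Matrix.mulVec_mulVec, Matrix.dotProduct_mulVec, dotProduct_single_one] at this
      exact this
    have h2 : A' ^ n * B' = (A ^ n * B).map Complex.ofReal := by
      change A' ^ n * B' = (A ^ n * B).map Complex.ofRealHom
      rw [Matrix.map_mul, Matrix.map_pow]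
      rfl
    ext k
    have := congrArg Complex.ofReal (congrFun h1 k)
    rw [h2]
    simpa [Matrix.vecMul, dotProduct] using this
  by_contra hp0
  have hnt : Nontrivial N := by
    refine ⟨⟨⟨_, hpN⟩, 0, fun h0 => hp0 ?_⟩⟩
    ext i
    have := congrFun (congrArg Subtype.val h0) i
    simpa using this
  obtain ⟨μ, hμ⟩ := Module.End.exists_eigenvalue (A'.vecMulLinear.restrict hinv)
  obtain ⟨q, hq⟩ := hμ.exists_hasEigenvector
  refine hq.2 (Subtype.ext (h μ q ?_ ?_))
  · have := congrArg Subtype.val hq.apply_eq_smul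
    exact this
  · have := (hN q).1 q.2 0
    simpa using this

end

/-- Partners in a matching are unique, so j ↦ partner is a permutation; its cycles are disjoint
cycles of G(A) covering all states. -/
theorem HasPerfectMatching.exists_perm {d : ℕ} {A : Pattern d d} (h : HasPerfectMatching A) :
    ∃ σ : Equiv.Perm (Fin d), ∀ j, A (σ j) j ≠ 0 := by
  obtain ⟨M, hM, hs⟩ := h
  have key : ∀ j : Fin d, ∃ i : Fin d, M.Adj (Sum.inl j) (Sum.inr i) := fun j => by
    obtain ⟨v, hv, -⟩ := hM (hs (Sum.inl j))
    rcases v with j' | i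
    · exact (M.adj_sub hv).elim
    · exact ⟨i, hv⟩
  choose f hf using key
  have hinj : Function.Injective f := fun j j' hj => by
    obtain ⟨v, -, hv⟩ := hM (hs (Sum.inr (f j)))
    have h1 := hv _ (hf j).symm
    have h2 := hv (Sum.inl j') (by rw [hj]; exact (hf j').symm)
    exact Sum.inl_injective (h1.trans h2.symm)
  exact ⟨Equiv.ofBijective f (Finite.injective_iff_bijective.1 hinj), fun j => M.adj_sub (hf j)⟩

/-- Distance from a set of roots: if every point is reachable from a root, then there is a rank
function vanishing only at roots, such that each point of rank `n + 1` has a predecessor of rank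
`n`. -/
theorem exists_rank {α : Type*} (R : α → α → Prop) (P : α → Prop)
    (h : ∀ a, ∃ r, P r ∧ Relation.ReflTransGen R r a) :
    ∃ f : α → ℕ, (∀ a, f a = 0 → P a) ∧ ∀ a n, f a = n + 1 → ∃ b, R b a ∧ f b = n := by
  classical
  -- `step n a`: a is reached from a root in exactly n steps. The rank is the least such n.
  let step : ℕ → α → Prop := fun n => Nat.rec (motive := fun _ => α → Prop) P (fun _ Q a => ∃ b, R b a ∧ Q b) n
  have hex : ∀ a, ∃ n, step n a := fun a => by
    obtain ⟨r, hr, hra⟩ := h a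
    induction hra with
    | refl => exact ⟨0, hr⟩
    | tail _ hbc ih =>
      obtain ⟨n, hn⟩ := ih
      exact ⟨n + 1, _, hbc, hn⟩
  refine ⟨fun a => Nat.find (hex a), fun a ha => ?_, fun a n ha => ?_⟩
  · have hs : step _ a := Nat.find_spec (hex a)
    rwa [show Nat.find (hex a) = 0 from ha] at hs
  · have hs : step _ a := Nat.find_spec (hex a)
    replace ha : Nat.find (hex a) = n + 1 := ha
    rw [ha] at hs
    obtain ⟨b, hba, hb⟩ := hs
    refine ⟨b, hba, le_antisymm (Nat.find_min' _ hb) ?_⟩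
    by_contra! hlt
    have := Nat.find_min' (hex a) (m := Nat.find (hex b) + 1) ⟨b, hba, Nat.find_spec (hex b)⟩
    omega

/-! ### Left eigenvectors of weighted cycles joined by parent edges. -/

section Cycles

variable {V Q : Type*} [Fintype V]

/-- On a cycle of `σ` where `μ q = c (q ∘ σ)` with `q` nonzero, `c = ‖μ‖`. -/
theorem norm_eq_of_cycle (σ : Equiv.Perm V) (cyc : V → Q) (hσ : ∀ j, cyc (σ j) = cyc j)
    {q : V → ℂ} {μ : ℂ} {c : ℝ} (hc : 0 < c) (D : Q)
    (h : ∀ j, cyc j = D → (c : ℂ) * q (σ j) = μ * q j) {v : V} (hv : cyc v = D) (hqv : q v ≠ 0) :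
    c = ‖μ‖ := by
  classical
  -- σ permutes the cycle, so summing moduli over it leaves c = ‖μ‖.
  have hsum : ∑ j with cyc j = D, ‖q (σ j)‖ = ∑ j with cyc j = D, ‖q j‖ :=
    Finset.sum_equiv σ (by simp [hσ]) (fun _ _ => rfl)
  have hmul : c * ∑ j with cyc j = D, ‖q (σ j)‖ = ‖μ‖ * ∑ j with cyc j = D, ‖q j‖ := by
    rw [Finset.mul_sum, Finset.mul_sum]
    refine Finset.sum_congr rfl fun j hj => ?_
    have := congrArg norm (h j (Finset.mem_filter.1 hj).2)
    simpa [abs_of_pos hc] using this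
  have hpos : 0 < ∑ j with cyc j = D, ‖q j‖ :=
    Finset.sum_pos' (fun _ _ => norm_nonneg _) ⟨v, by simp [hv], by simpa using hqv⟩
  rw [hsum] at hmul
  exact mul_right_cancel₀ hpos.ne' hmul

/-- A zero of `q` propagates along the whole cycle of `σ`, if it propagates along all steps but
the one that leaves `s`. -/
theorem eq_zero_of_sameCycle (σ : Equiv.Perm V) {q : V → ℂ} {s v : V}
    (hv : q v = 0) (hvs : σ.SameCycle v s)
    (h : ∀ j, σ.SameCycle j s → j ≠ s → q j = 0 → q (σ j) = 0) :
    q s = 0 := by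
  obtain ⟨n, -, hn⟩ := hvs.exists_pow_eq'
  induction n generalizing v with
  | zero => simpa [← hn] using hv
  | succ n ih =>
    by_cases hne : v = s
    · rwa [← hne]
    · exact ih (h v hvs hne hv) (Equiv.Perm.sameCycle_apply_left.2 hvs)
        (by rw [← hn, pow_succ]; rfl)

end Cycles

/-- The column sums over the parent edges: each `D` with `f D ≠ 0` contributes the edge from `s D`
to `t D`. -/
noncomputable def parentSum {V Q : Type*} [Fintype V] [DecidableEq V] (cyc : V → Q) (f : Q → ℕ)
    (t s : Q → V) (q : V → ℂ) (j : V) : ℂ :=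
  ∑ i, if f (cyc i) ≠ 0 ∧ i = t (cyc i) ∧ j = s (cyc i) then q i else 0

theorem parentSum_eq_zero {V Q : Type*} [Fintype V] [DecidableEq V] {cyc : V → Q} {f : Q → ℕ}
    {t s : Q → V} {q : V → ℂ} {j : V} (h : ∀ D, f D ≠ 0 → s D = j → q (t D) = 0) :
    parentSum cyc f t s q j = 0 := by
  refine Finset.sum_eq_zero fun i _ => ?_
  split_ifs with hi
  · rw [hi.2.1]
    exact h _ hi.1 hi.2.2.symm
  · rfl

theorem parentSum_eq_single {V Q : Type*} [Fintype V] [DecidableEq V] {cyc : V → Q} {f : Q → ℕ}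
    {t s : Q → V} {q : V → ℂ} (ht : ∀ D, cyc (t D) = D) {E : Q} (hE : f E ≠ 0)
    (h : ∀ D, f D ≠ 0 → s D = s E → q (t D) ≠ 0 → D = E) :
    parentSum cyc f t s q (s E) = q (t E) := by
  rw [parentSum, Finset.sum_eq_single (t E)]
  · rw [ht, if_pos ⟨hE, rfl, rfl⟩]
  · intro i _ hi
    split_ifs with hc
    · by_contra hq
      rw [hc.2.1] at hq
      exact hi (hc.2.1.trans (congrArg t (h _ hc.1 hc.2.2.symm hq)))
    · rfl
  · simp

section Eigenvector

variable {V Q : Type*} [Fintype V] [DecidableEq V] {σ : Equiv.Perm V} {cyc : V → Q} {f : Q → ℕ}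
  {t s : Q → V} {c : Q → ℝ} {q : V → ℂ} {μ : ℂ}

/-- A left eigenvector of the weighted cycles with parent edges is, at rank zero, supported on
exactly one cycle and vanishes nowhere on it. -/
theorem exists_unique_root (hcyc : ∀ i j, cyc i = cyc j ↔ σ.SameCycle i j)
    (hc : ∀ D, 0 < c D) (hcinj : Function.Injective c) (ht : ∀ D, cyc (t D) = D)
    (hs : ∀ D, f D ≠ 0 → f (cyc (s D)) + 1 = f D)
    (hq : ∀ j, (c (cyc j) : ℂ) * q (σ j) + parentSum cyc f t s q j = μ * q j) (hq0 : q ≠ 0) :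
    ∃ E, f E = 0 ∧ (∀ v, cyc v = E → q v ≠ 0) ∧ ∀ v, f (cyc v) = 0 → q v ≠ 0 → cyc v = E := by
  have hσ : ∀ j, cyc (σ j) = cyc j := fun j =>
    (hcyc _ _).2 (Equiv.Perm.sameCycle_apply_left.2 (Equiv.Perm.SameCycle.refl _ _))
  have hcne : ∀ D, (c D : ℂ) ≠ 0 := fun D => Complex.ofReal_ne_zero.2 (hc D).ne'
  obtain ⟨w, hw⟩ := Function.ne_iff.1 hq0
  -- Take v₀ of greatest rank in the support: no parent term from above reaches that rank, so the
  -- recurrence is homogeneous there.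
  obtain ⟨v₀, hv₀, hmax⟩ := Finset.exists_max_image (Finset.univ.filter fun v => q v ≠ 0)
    (fun v => f (cyc v)) ⟨w, by simpa using hw⟩
  replace hv₀ : q v₀ ≠ 0 := by simpa using hv₀
  replace hmax : ∀ v, f (cyc v₀) < f (cyc v) → q v = 0 := fun v hv => by
    by_contra hne
    exact absurd (hmax v (by simpa using hne)) (not_le.2 hv)
  have homog : ∀ v, q v ≠ 0 → (∀ j, cyc j = cyc v → parentSum cyc f t s q j = 0) →
      c (cyc v) = ‖μ‖ := fun v hv hD => by
    refine norm_eq_of_cycle σ cyc hσ (hc _) (cyc v) (fun j hj => ?_) rfl hv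
    have := hq j
    rwa [hD j hj, add_zero, hj] at this
  have htop : ∀ j, f (cyc j) = f (cyc v₀) → parentSum cyc f t s q j = 0 := fun j hj =>
    parentSum_eq_zero fun D hD hsD => hmax _ (by
      have := hs D hD
      rw [hsD, hj] at this
      rw [ht]
      omega)
  have hμ : c (cyc v₀) = ‖μ‖ := homog v₀ hv₀ fun j hj => htop j (by rw [hj])
  have hμ0 : μ ≠ 0 := norm_pos_iff.1 (hμ ▸ hc _)
  -- Descend from the rank of v₀ to rank 0; n counts the levels below the top.
  have main : ∀ n r, r + n = f (cyc v₀) → ∃ E, f E = r ∧ (∀ v, cyc v = E → q v ≠ 0) ∧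
      ∀ v, f (cyc v) = r → q v ≠ 0 → cyc v = E := by
    intro n
    induction n with
    | zero =>
      intro r hr
      have hr : f (cyc v₀) = r := hr.symm
      subst hr
      refine ⟨cyc v₀, rfl, fun v hv hqv => hv₀ ?_, fun v hv hqv => hcinj ?_⟩
      · refine eq_zero_of_sameCycle σ hqv ((hcyc _ _).1 hv) fun j hj _ hqj => ?_
        have := hq j
        rw [htop j (by rw [(hcyc _ _).2 hj]), hqj, mul_zero, add_zero] at this
        exact (mul_eq_zero.1 this).resolve_left (hcne _)
      · rw [hμ]
        exact homog v hqv fun j hj => htop j (by rw [hj, hv])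
    | succ n ih =>
      intro r hr
      obtain ⟨E', hE', hall, huniq⟩ := ih (r + 1) (by omega)
      have hE'0 : f E' ≠ 0 := by omega
      have hone : ∀ D, f D = r + 1 → q (t D) ≠ 0 → D = E' := fun D hD hqD => by
        simpa [ht] using huniq (t D) (by rw [ht, hD]) hqD
      have hrank : ∀ D, f D ≠ 0 → f (cyc (s D)) = r → f D = r + 1 := fun D hD hsD => by
        have := hs D hD
        omega
      have hsE : f (cyc (s E')) = r := by
        have := hs E' hE'0
        omega
      have hsingle : ∀ j, f (cyc j) = r → j ≠ s E' → parentSum cyc f t s q j = 0 :=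
        fun j hj hne => parentSum_eq_zero fun D hD hsD => by
          by_contra hqD
          have := hone D (hrank D hD (by rw [hsD, hj])) hqD
          exact hne (by rw [← hsD, this])
      refine ⟨cyc (s E'), hsE, fun v hv hqv => ?_, fun v hv hqv => ?_⟩
      · have hvs := (hcyc _ _).1 hv
        -- A zero on the parent cycle spreads forward to `s E'` and backward to `σ (s E')`; the
        -- equation at `s E'` then forces q to vanish at `t E'`, a contradiction.
        have hfwd : q (s E') = 0 := eq_zero_of_sameCycle σ hqv hvs fun j hj hne hqj => by
          have := hq j
          rw [hsingle j (by rw [(hcyc _ _).2 hj, hsE]) hne, hqj, mul_zero, add_zero] at this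
          exact (mul_eq_zero.1 this).resolve_left (hcne _)
        have hbwd : q (σ (s E')) = 0 := by
          -- Going backward uses μ ≠ 0; the only step not available is the one from `σ (s E')` to `s
          -- E'`.
          refine eq_zero_of_sameCycle σ⁻¹ hqv
            (Equiv.Perm.sameCycle_inv.2 (Equiv.Perm.sameCycle_apply_right.2 hvs))
            fun j hj hne hqj => ?_
          obtain ⟨i, rfl⟩ := σ.surjective j
          have hi : σ.SameCycle i (s E') := Equiv.Perm.sameCycle_apply_left.1
            (Equiv.Perm.sameCycle_apply_right.1 (Equiv.Perm.sameCycle_inv.1 hj))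
          have := hq i
          rw [hsingle i (by rw [(hcyc _ _).2 hi, hsE]) (fun h => hne (by rw [h])), hqj, mul_zero,
            add_zero] at this
          rw [show σ⁻¹ (σ i) = i from σ.symm_apply_apply i]
          exact (mul_eq_zero.1 this.symm).resolve_left hμ0
        have := hq (s E')
        rw [hfwd, hbwd, mul_zero, mul_zero, zero_add, parentSum_eq_single ht hE'0
          fun D hD hsD => hone D (hrank D hD (by rw [hsD, hsE]))] at this
        exact hall _ (ht E') this
      · by_contra hne
        -- A cycle of rank r without parent term would have weight ‖μ‖, hence be the cycle of v₀,
        -- whose rank is larger.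
        have h1 := homog v hqv fun j hj => hsingle j (by rw [hj, hv])
          (by rintro rfl; exact hne hj.symm)
        have h2 := hcinj (h1.trans hμ.symm)
        rw [h2] at hv
        omega
  exact main (f (cyc v₀)) 0 (zero_add _)

end Eigenvector

/-- If the state vertices are covered by disjoint cycles of `G(A)` and each of them can be reached
from a vertex with an input, then `(A, B)` is structurally controllable. -/
theorem structurallyControllable_of_reachable {d m : ℕ} {A : Pattern d d} {B : Pattern d m}
    (σ : Equiv.Perm (Fin d)) (hσ : ∀ j, A (σ j) j ≠ 0)
    (hreach : ∀ i, ∃ l, (∃ k, B l k ≠ 0) ∧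
      Relation.ReflTransGen (stateDigraph A).Adj l i) :
    StructurallyControllable A B := by
  classical
  let Q := Quotient (Equiv.Perm.SameCycle.setoid σ)
  let cyc : Fin d → Q := Quotient.mk _
  have hcyc : ∀ i j, cyc i = cyc j ↔ σ.SameCycle i j := fun i j => Quotient.eq
  have hsurj : ∀ D, ∃ i, cyc i = D := Quotient.exists_rep
  obtain ⟨f, hf0, hf1⟩ := exists_rank
    (fun C D : Q => ∃ j i, cyc j = C ∧ cyc i = D ∧ A i j ≠ 0)
    (fun D => ∃ l, cyc l = D ∧ ∃ k, B l k ≠ 0) (fun D => by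
      obtain ⟨i, rfl⟩ := hsurj D
      obtain ⟨l, hl, hli⟩ := hreach i
      exact ⟨cyc l, ⟨l, rfl, hl⟩, hli.lift cyc fun a b hab => ⟨a, b, rfl, rfl, hab⟩⟩)
  have hdata : ∀ D, ∃ t s, cyc t = D ∧ (f D = 0 → ∃ k, B t k ≠ 0) ∧
      (f D ≠ 0 → A t s ≠ 0 ∧ f (cyc s) + 1 = f D) := fun D => by
    rcases hn : f D with _ | n
    · obtain ⟨l, hl, hk⟩ := hf0 D hn
      -- At rank 0 there is no parent edge; the second l is a dummy.
      exact ⟨l, l, hl, fun _ => hk, by simp⟩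
    · obtain ⟨C, ⟨j, i, rfl, rfl, hij⟩, hC⟩ := hf1 D n hn
      exact ⟨i, j, rfl, by simp, fun _ => ⟨hij, by rw [hC]⟩⟩
  choose t s ht hk hs using hdata
  -- Any distinct positive weights serve; the + 1 ensures positivity.
  let c : Q → ℝ := fun D => (Fintype.equivFin Q D : ℕ) + 1
  have hcpos : ∀ D, 0 < c D := fun D => by positivity
  have hcinj : Function.Injective c := fun C D h => by
    have h1 : ((Fintype.equivFin Q C : ℕ) : ℝ) = (Fintype.equivFin Q D : ℕ) := add_right_cancel h
    exact (Fintype.equivFin Q).injective (Fin.ext (Nat.cast_injective h1))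
  let A' : Matrix (Fin d) (Fin d) ℝ := Matrix.of fun i j => (if i = σ j then c (cyc j) else 0) +
    if f (cyc i) ≠ 0 ∧ i = t (cyc i) ∧ j = s (cyc i) then 1 else 0
  let B' : Matrix (Fin d) (Fin m) ℝ := Matrix.of fun l k =>
    if f (cyc l) = 0 ∧ l = t (cyc l) ∧ B l k ≠ 0 then 1 else 0
  refine ⟨A', B', fun i j hij => ?_, fun l k hlk => ?_,
    isControllable_of_hautus A' B' fun μ q hqA hqB => ?_⟩
  · have h1 : i ≠ σ j := fun h => hσ j (h ▸ hij)
    have h2 : ¬ (f (cyc i) ≠ 0 ∧ i = t (cyc i) ∧ j = s (cyc i)) := fun ⟨h, hi, hj⟩ =>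
      (hs _ h).1 (by rwa [← hi, ← hj])
    simp only [A', Matrix.of_apply, if_neg h1, if_neg h2, add_zero]
  · exact if_neg fun h => h.2.2 hlk
  · by_contra hq0
    obtain ⟨E, hE, hall, huniq⟩ := exists_unique_root (f := f) (s := s) (μ := μ) hcyc hcpos hcinj ht
      (fun D hD => (hs D hD).2) (fun j => by
        have := congrFun hqA j
        rw [Pi.smul_apply, smul_eq_mul] at this
        rw [← this]
        simp only [Matrix.vecMul, dotProduct, Matrix.map_apply, A', Matrix.of_apply, Complex.ofReal_add, mul_add,
          Finset.sum_add_distrib, parentSum]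
        congr 1
        · rw [Finset.sum_eq_single (σ j)]
          · rw [if_pos rfl, mul_comm]
          · intro i _ hi
            rw [if_neg hi, Complex.ofReal_zero, mul_zero]
          · simp
        · refine Finset.sum_congr rfl fun i _ => ?_
          split_ifs <;> simp) hq0
    obtain ⟨k, hBk⟩ := hk E hE
    have := congrFun hqB k
    rw [Matrix.vecMul, dotProduct, Finset.sum_eq_single (t E)] at this
    · exact hall _ (ht E) (by simpa [B', ht, hE, hBk] using this)
    · intro l _ hl
      rw [Matrix.map_apply]
      by_cases hc : f (cyc l) = 0 ∧ l = t (cyc l) ∧ B l k ≠ 0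
      · by_contra hne
        have hql : q l ≠ 0 := left_ne_zero_of_mul hne
        exact hl (hc.2.1.trans (congrArg t (huniq l hc.1 hql)))
      · simp only [B', Matrix.of_apply, if_neg hc, Complex.ofReal_zero, mul_zero]
    · simp

/-! ### Necessity of an input at each source component. -/

/-- If no edge of the realisation enters the nonempty set `S` from outside and no input acts on it,
then the system is not controllable. -/
theorem IsControllable.exists_input_ne_zero {d m : ℕ} {A : Matrix (Fin d) (Fin d) ℝ}
    {B : Matrix (Fin d) (Fin m) ℝ} (h : IsControllable A B) {S : Set (Fin d)} (hS : S.Nonempty)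
    (hA : ∀ i ∈ S, ∀ j ∉ S, A i j = 0) : ∃ i ∈ S, ∃ k, B i k ≠ 0 := by
  classical
  by_contra! hB
  obtain ⟨T, hT, u, x, -, h0, h1, hx⟩ := h 0 1
  let M : Matrix (Fin d) (Fin d) ℝ := Matrix.of fun i j => if i ∈ S then A i j else 0
  -- The part of the trajectory in S solves y' = M y with y(0) = 0, so uniqueness contradicts the
  -- target value 1.
  let y : ℝ → Fin d → ℝ := fun t i => if i ∈ S then x t i else 0
  have hy : ∀ t ∈ Set.Icc 0 T, HasDerivWithinAt y (mulVecCLM M (y t)) (Set.Icc 0 T) t :=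
    fun t ht => by
    refine hasDerivWithinAt_pi.2 fun i => ?_
    have hxi := hasDerivWithinAt_pi.1 (hx t ht) i
    by_cases hi : i ∈ S
    · convert hxi using 1
      · funext s
        simp [y, hi]
      · have h2 : (B *ᵥ u t) i = 0 := by simp [Matrix.mulVec, dotProduct, hB i hi]
        rw [Pi.add_apply, h2, add_zero, mulVecCLM_apply]
        simp only [Matrix.mulVec, dotProduct]
        refine Finset.sum_congr rfl fun j _ => ?_
        by_cases hj : j ∈ S
        · simp [M, y, hi, hj]
        · simp [M, y, hi, hj, hA i hi j hj]
    · have h2 : (mulVecCLM M (y t)) i = 0 := by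
        simp [Matrix.mulVec, dotProduct, M, hi]
      rw [h2]
      simpa [y, hi] using hasDerivWithinAt_const t (Set.Icc 0 T) (0 : ℝ)
  have hIci : ∀ t ∈ Set.Ico 0 T, ∀ {g : ℝ → Fin d → ℝ} {g'},
      HasDerivWithinAt g g' (Set.Icc 0 T) t → HasDerivWithinAt g g' (Set.Ici t) t :=
    fun t ht g g' hg => (hg.mono (Set.Icc_subset_Icc_left ht.1)).mono_of_mem_nhdsWithin
      (Icc_mem_nhdsGE ht.2)
  have heq := ODE_solution_unique (v := fun _ => mulVecCLM M) (g := fun _ => 0)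
    (fun _ => (mulVecCLM M).lipschitz) (fun t ht => (hy t ht).continuousWithinAt)
    (fun t ht => hIci t ht (hy t (Set.Ico_subset_Icc_self ht))) continuousOn_const
    (fun t _ => by simpa using hasDerivWithinAt_const t (Set.Ici t) (0 : Fin d → ℝ))
    (by ext i; simp [y, h0]) (Set.right_mem_Icc.2 hT.le)
  obtain ⟨i, hi⟩ := hS
  have := congrFun heq i
  simp [y, hi, h1] at this

/-! ### Strongly connected components. -/

section Components

variable {V : Type*} (G : Digraph V)

/-- The vertices that can be reached from `v` and from which `v` can be reached. -/
def mutuallyReachable (v : V) : Set V :=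
  {u | Relation.ReflTransGen G.Adj v u ∧ Relation.ReflTransGen G.Adj u v}

theorem mem_mutuallyReachable_self (v : V) : v ∈ mutuallyReachable G v :=
  ⟨.refl, .refl⟩

theorem stronglyConnectedOn_mutuallyReachable (v : V) :
    StronglyConnectedOn G (mutuallyReachable G v) := by
  refine ⟨⟨v, mem_mutuallyReachable_self G v⟩, fun a ha b hb => ?_⟩
  have hab := ha.2.trans hb.1
  induction hab using Relation.ReflTransGen.head_induction_on with
  | refl => exact .refl
  | head hac hcb ih =>
    have hc := And.intro (ha.1.tail hac) (hcb.trans hb.2)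
    exact .head ⟨ha, hc, hac⟩ (ih hc)

variable {G}

theorem StronglyConnectedOn.reachable {S : Set V} (h : StronglyConnectedOn G S) {a b : V}
    (ha : a ∈ S) (hb : b ∈ S) : Relation.ReflTransGen G.Adj a b :=
  Relation.ReflTransGen.mono (fun _ _ hxy => hxy.2.2) a b (h.2 a ha b hb)

theorem StronglyConnectedOn.subset_mutuallyReachable {S : Set V} (h : StronglyConnectedOn G S)
    {v : V} (hv : v ∈ S) : S ⊆ mutuallyReachable G v :=
  fun _ hu => ⟨h.reachable hv hu, h.reachable hu hv⟩

variable (G) in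
theorem isSCC_mutuallyReachable (v : V) : IsSCC G (mutuallyReachable G v) :=
  ⟨stronglyConnectedOn_mutuallyReachable G v, fun _ hT hle =>
    hT.subset_mutuallyReachable (hle (mem_mutuallyReachable_self G v))⟩

theorem IsSCC.eq_mutuallyReachable {S : Set V} (h : IsSCC G S) {v : V} (hv : v ∈ S) :
    S = mutuallyReachable G v :=
  h.eq_of_le (stronglyConnectedOn_mutuallyReachable G v) (h.prop.subset_mutuallyReachable hv)

/-- Every vertex outside S lies in its own component, which differs from S. -/
theorem IsSSCC.not_adj {S : Set V} (h : IsSSCC G S) {a b : V} (ha : a ∉ S) (hb : b ∈ S) :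
    ¬ G.Adj a b :=
  h.2 _ (isSCC_mutuallyReachable G a)
    (fun heq => ha (heq ▸ mem_mutuallyReachable_self G a)) a (mem_mutuallyReachable_self G a) b hb

theorem IsSSCC.disjoint {S T : Set V} (hS : IsSSCC G S) (hT : IsSSCC G T) (hne : S ≠ T) :
    Disjoint S T :=
  Set.disjoint_left.2 fun _ hvS hvT =>
    hne ((hS.1.eq_mutuallyReachable hvS).trans (hT.1.eq_mutuallyReachable hvT).symm)

/-- In a finite digraph each vertex can be reached from every vertex of some source component. -/
theorem exists_isSSCC_reachable [Finite V] (i : V) :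
    ∃ S, IsSSCC G S ∧ ∀ l ∈ S, Relation.ReflTransGen G.Adj l i := by
  -- Among the ancestors of i choose v with fewest ancestors: an ancestor u of v then has the same
  -- ancestors, v among them, so v reaches u.
  obtain ⟨v, hvi, hmin⟩ := Set.exists_min_image {v | Relation.ReflTransGen G.Adj v i}
    (fun v => {u | Relation.ReflTransGen G.Adj u v}.ncard) (Set.toFinite _) ⟨i, .refl⟩
  have hback : ∀ u, Relation.ReflTransGen G.Adj u v → Relation.ReflTransGen G.Adj v u := by
    intro u huv
    have heq := Set.eq_of_subset_of_ncard_le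
      (fun w (hw : Relation.ReflTransGen G.Adj w u) => hw.trans huv)
      (hmin u (huv.trans hvi)) (Set.toFinite _)
    exact (Set.ext_iff.1 heq v).2 .refl
  refine ⟨mutuallyReachable G v, ⟨isSCC_mutuallyReachable G v, fun S' hS' hne a ha b hb hab => ?_⟩,
    fun l hl => hl.2.trans hvi⟩
  have hav := (Relation.ReflTransGen.single hab).trans hb.2
  refine hne ((hS'.eq_mutuallyReachable ha).trans
    ((isSCC_mutuallyReachable G v).eq_mutuallyReachable ⟨hback a hav, hav⟩).symm)

end Components

/-- Every source component of a structurally controllable pair has an input. -/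
theorem StructurallyControllable.exists_star {d m : ℕ} {A : Pattern d d} {B : Pattern d m}
    (h : StructurallyControllable A B) {S : Set (Fin d)} (hS : IsSSCC (stateDigraph A) S) :
    ∃ i ∈ S, ∃ k, B i k ≠ 0 := by
  obtain ⟨A', B', hA', hB', hc⟩ := h
  obtain ⟨i, hi, k, hk⟩ := hc.exists_input_ne_zero hS.1.prop.1 fun i hi j hj =>
    hA' i j (not_not.1 (hS.not_adj hj hi))
  exact ⟨i, hi, k, fun h0 => hk (hB' i k h0)⟩

/-- Under a perfect matching, an input at every source component suffices for structural
controllability. -/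
theorem structurallyControllable_of_star {d m : ℕ} {A : Pattern d d} {B : Pattern d m}
    (hA : HasPerfectMatching A)
    (h : ∀ S, IsSSCC (stateDigraph A) S → ∃ i ∈ S, ∃ k, B i k ≠ 0) :
    StructurallyControllable A B := by
  obtain ⟨σ, hσ⟩ := hA.exists_perm
  refine structurallyControllable_of_reachable σ hσ fun i => ?_
  obtain ⟨S, hS, hreach⟩ := exists_isSSCC_reachable (G := stateDigraph A) i
  obtain ⟨l, hl, hk⟩ := h S hS
  exact ⟨l, hk, hreach l hl⟩

/-! ### Correctness and cost of the algorithm. -/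

section Algorithm

variable {d m : ℕ} {B : Pattern d m} {w : Matrix (Fin d) (Fin m) ℝ}

theorem exists_loop (c : Fin d → Fin m → WithTop ℝ) (Ss : List (Set (Fin d)))
    (h : ∀ S ∈ Ss, S.Nonempty ∧ Nonempty (Fin m)) (L : Finset (Fin m × Fin d)) :
    ∃ L', Loop c Ss L L' := by
  induction Ss generalizing L with
  | nil => exact ⟨L, .nil L⟩
  | cons S Ss ih =>
    obtain ⟨hS, _⟩ := h S List.mem_cons_self
    choose κ hκ using fun i => Finite.exists_min (c i)
    obtain ⟨ℓ, hℓ, hmin⟩ := Set.exists_min_image S (fun i => c i (κ i)) (Set.toFinite S) hS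
    obtain ⟨L', hL'⟩ := ih (fun T hT => h T (List.mem_cons_of_mem S hT)) (insert (κ ℓ, ℓ) L)
    exact ⟨L', .cons S Ss L L' κ (fun i _ => hκ i) ℓ hℓ hmin hL'⟩

/-- The connection selected in a component is present in `B`, and is the cheapest one. -/
theorem selected_le {S : Set (Fin d)} {κ : Fin d → Fin m}
    (hκ : ∀ i ∈ S, ∀ j, algCost B w i (κ i) ≤ algCost B w i j) {ℓ : Fin d}
    (hmin : ∀ i ∈ S, algCost B w ℓ (κ ℓ) ≤ algCost B w i (κ i)) {i : Fin d} (hi : i ∈ S)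
    {k : Fin m} (hk : B i k ≠ 0) : B ℓ (κ ℓ) ≠ 0 ∧ w ℓ (κ ℓ) ≤ w i k := by
  have h := (hmin i hi).trans (hκ i hi k)
  unfold algCost at h
  rw [if_pos hk] at h
  split_ifs at h with h0
  · exact ⟨h0, WithTop.coe_le_coe.1 h⟩
  · exact absurd (top_le_iff.1 h) (WithTop.coe_ne_top)

theorem Loop.subset {c : Fin d → Fin m → WithTop ℝ} {Ss : List (Set (Fin d))}
    {L L' : Finset (Fin m × Fin d)} (h : Loop c Ss L L') : L ⊆ L' := by
  induction h with
  | nil L => exact subset_rfl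
  | cons S Ss L L' κ hκ ℓ hmem hmin hrest ih => exact (Finset.subset_insert _ _).trans ih

theorem Loop.exists_mem {c : Fin d → Fin m → WithTop ℝ} {Ss : List (Set (Fin d))}
    {L L' : Finset (Fin m × Fin d)} (h : Loop c Ss L L') :
    ∀ S ∈ Ss, ∃ p ∈ L', p.2 ∈ S := by
  induction h with
  | nil L => simp
  | cons S Ss L L' κ hκ ℓ hmem hmin hrest ih =>
    rintro T (_ | ⟨_, hT⟩)
    · exact ⟨(κ ℓ, ℓ), hrest.subset (Finset.mem_insert_self _ _), hmem⟩
    · exact ih T hT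

/-- A component with a star of B has finite least cost, so a connection of cost ⊤ is never selected.
-/
theorem Loop.ne_zero {Ss : List (Set (Fin d))} {L L' : Finset (Fin m × Fin d)}
    (h : Loop (algCost B w) Ss L L') (hSs : ∀ S ∈ Ss, ∃ i ∈ S, ∃ k, B i k ≠ 0)
    (hL : ∀ p ∈ L, B p.2 p.1 ≠ 0) : ∀ p ∈ L', B p.2 p.1 ≠ 0 := by
  induction h with
  | nil L => exact hL
  | cons S Ss L L' κ hκ ℓ hmem hmin hrest ih =>
    refine ih (fun T hT => hSs T (List.mem_cons_of_mem S hT)) fun p hp => ?_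
    obtain ⟨i, hi, k, hk⟩ := hSs S List.mem_cons_self
    rcases Finset.mem_insert.1 hp with rfl | hp
    · exact (selected_le hκ hmin hi hk).1
    · exact hL p hp

open Classical in
/-- Cost bound for the loop: if `g` bounds the cost of some connection in each component, then the
cost of the selected connections is at most the total of `g` over the components. -/
theorem Loop.sum_le {Ss : List (Set (Fin d))} {L L' : Finset (Fin m × Fin d)}
    (h : Loop (algCost B w) Ss L L') {g : Fin d → ℝ}
    (hg : ∀ i, 0 ≤ g i) (hSs : ∀ S ∈ Ss, ∃ i ∈ S, ∃ k, B i k ≠ 0 ∧ w i k ≤ g i)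
    (hdisj : Ss.Pairwise Disjoint) :
    ∑ p ∈ L', w p.2 p.1 ≤ ∑ p ∈ L, w p.2 p.1 + ∑ i, if ∃ S ∈ Ss, i ∈ S then g i else 0 := by
  induction h with
  | nil L => simp
  | cons S Ss L L' κ hκ ℓ hmem hmin hrest ih =>
    rw [List.pairwise_cons] at hdisj
    have ih := ih (fun T hT => hSs T (List.mem_cons_of_mem S hT)) hdisj.2
    obtain ⟨i, hi, k, hk, hki⟩ := hSs S List.mem_cons_self
    obtain ⟨hℓ, hle⟩ := selected_le hκ hmin hi hk
    have hins : ∑ p ∈ insert (κ ℓ, ℓ) L, w p.2 p.1 ≤ g i + ∑ p ∈ L, w p.2 p.1 := by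
      by_cases hp : (κ ℓ, ℓ) ∈ L
      · rw [Finset.insert_eq_of_mem hp]
        linarith [hg i]
      · rw [Finset.sum_insert hp]
        linarith
    have hS : g i ≤ ∑ j, if j ∈ S then g j else 0 := by
      have := Finset.single_le_sum (f := fun j => if j ∈ S then g j else 0)
        (fun j _ => by split_ifs <;> simp [hg]) (Finset.mem_univ i)
      simpa [hi] using this
    -- Disjointness ensures that no row is charged to two components.
    have hsplit : ∑ j, (if ∃ T ∈ S :: Ss, j ∈ T then g j else 0) =
        (∑ j, if j ∈ S then g j else 0) + ∑ j, if ∃ T ∈ Ss, j ∈ T then g j else 0 := by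
      rw [← Finset.sum_add_distrib]
      refine Finset.sum_congr rfl fun j _ => ?_
      by_cases hj : j ∈ S
      · have : ¬ ∃ T ∈ Ss, j ∈ T := fun ⟨T, hT, hjT⟩ =>
          Set.disjoint_left.1 (hdisj.1 T hT) hj hjT
        simp [hj, this]
      · simp [hj]
    rw [hsplit]
    linarith

theorem patternOf_ne_zero {L : Finset (Fin m × Fin d)} {i : Fin d} {k : Fin m} :
    patternOf L i k ≠ 0 ↔ (k, i) ∈ L := by
  unfold patternOf
  split_ifs with h
  · exact ⟨fun _ => h, fun _ h0 => Entry.noConfusion h0⟩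
  · simp [h]

theorem totalCost_patternOf (w : Matrix (Fin d) (Fin m) ℝ) (L : Finset (Fin m × Fin d)) :
    totalCost w (patternOf L) = ∑ p ∈ L, w p.2 p.1 := by
  simp only [totalCost, patternOf_ne_zero]
  rw [Finset.sum_comm, ← Finset.sum_product', Finset.univ_product_univ]
  simp [Finset.sum_ite_mem]

/-- A feasible pattern costs at least as much as the connections selected by the algorithm. -/
theorem Loop.totalCost_le {A : Pattern d d} (hw : ∀ i j, B i j ≠ 0 → 0 ≤ w i j)
    {Ss : List (Set (Fin d))} (hnd : Ss.Nodup)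
    (hSs : ∀ S ∈ Ss, IsSSCC (stateDigraph A) S) {L : Finset (Fin m × Fin d)}
    (h : Loop (algCost B w) Ss ∅ L) {B' : Pattern d m} (hB' : B' ∈ feasible A B) :
    totalCost w (patternOf L) ≤ totalCost w B' := by
  classical
  have hsub : ∀ i k, B' i k ≠ 0 → B i k ≠ 0 := fun i k hk h0 =>
    hk (hB'.1 (show (i, k) ∈ fixedZeros B from h0))
  have hterm : ∀ i k, 0 ≤ w i k * (if B' i k ≠ 0 then 1 else 0) := fun i k => by
    split_ifs with hk
    · simpa using hw i k (hsub i k hk)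
    · simp
  -- The bound g is the row cost of B': it dominates each starred entry of its row, and its total is
  -- the cost of B'.
  have hg : ∀ i, 0 ≤ ∑ k, w i k * (if B' i k ≠ 0 then 1 else 0) :=
    fun i => Finset.sum_nonneg fun k _ => hterm i k
  have hle := h.sum_le hg (fun S hS => by
    obtain ⟨i, hi, k, hk⟩ := hB'.2.exists_star (hSs S hS)
    refine ⟨i, hi, k, hsub i k hk, ?_⟩
    have := Finset.single_le_sum (f := fun k => w i k * (if B' i k ≠ 0 then 1 else 0))
      (fun k _ => hterm i k) (Finset.mem_univ k)
    simpa [hk] using this)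
    (hnd.imp_of_mem fun hS hT hne => (hSs _ hS).disjoint (hSs _ hT) hne)
  rw [totalCost_patternOf]
  refine hle.trans ?_
  rw [Finset.sum_empty, zero_add]
  refine Finset.sum_le_sum fun i _ => ?_
  split_ifs
  · exact le_rfl
  · exact hg i

end Algorithm

end StructCtrl

theorem mainTheorem4 {d m : ℕ} (A : StructCtrl.Pattern d d) (B : StructCtrl.Pattern d m)
    (w : Matrix (Fin d) (Fin m) ℝ)
    (hw : ∀ i j, B i j ≠ 0 → 0 ≤ w i j)
    (hAB : StructCtrl.StructurallyControllable A B)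
    (hA : StructCtrl.HasPerfectMatching A) :
    (∃ Bs, StructCtrl.IsAlgorithmOutput A B w Bs) ∧
      ∀ Bs, StructCtrl.IsAlgorithmOutput A B w Bs → StructCtrl.SolvesMinCost A B w Bs := by
  classical
  open StructCtrl in
  refine ⟨?_, ?_⟩
  · have hfin : {S | IsSSCC (stateDigraph A) S}.Finite := Set.toFinite _
    have hmem : ∀ S, S ∈ hfin.toFinset.toList ↔ IsSSCC (stateDigraph A) S := by simp
    obtain ⟨L, hL⟩ := exists_loop (algCost B w) hfin.toFinset.toList (fun S hS => by
      obtain ⟨i, hi, k, -⟩ := hAB.exists_star ((hmem S).1 hS)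
      exact ⟨⟨i, hi⟩, ⟨k⟩⟩) ∅
    exact ⟨patternOf L, _, Finset.nodup_toList _, hmem, L, hL, rfl⟩
  · rintro _ ⟨Ss, hnd, hSs, L, hL, rfl⟩
    refine ⟨⟨fun p hp => ?_, ?_⟩, fun B' hB' =>
      hL.totalCost_le hw hnd (fun S hS => (hSs S).1 hS) hB'⟩
    · by_contra hne
      exact hL.ne_zero (fun S hS => hAB.exists_star ((hSs S).1 hS)) (by simp) _
        (patternOf_ne_zero.1 hne) hp
    · refine structurallyControllable_of_star hA fun S hS => ?_
      obtain ⟨p, hp, hpS⟩ := hL.exists_mem S ((hSs S).2 hS)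
      exact ⟨p.2, hpS, p.1, patternOf_ne_zero.2 hp⟩
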